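/- Let $(\mathcal{C},\mathbb{E},\mathfrak{s})$ be an extriangulated category (in the sense of Nakaoka–Palu) with $\mathcal C\neq 0$, and let $\xi$ be a proper class of $\mathbb{E}$-triangles in $\mathcal C$, i.e. a class of $\mathbb{E}$-triangles that is closed under isomorphisms, finite coproducts, base change and cobase change, contains all split $\mathbb{E}$-triangles, and is saturated: for $\mathbb{E}$-triangles $A_1\to B_1\to X$ realizing $\delta_1$ and $A_2\to B_2\xrightarrow{y_2}X$, if the second one and an $\mathbb{E}$-triangle $A_1\to M\to B_2$ realizing $y_2^*\delta_1$ lie in $\xi$, then so does the first. An object $P$ is $\xi$-projective if $0\to\mathcal C(P,A)\to\mathcal C(P,B)\to\mathcal C(P,X)\to 0$ is exact for every $\mathbb{E}$-triangle $A\to B\to X\dashrightarrow$ in $\xi$; $\xi$-injective objects are defined dually; $\mathcal P(\xi)$ is the class of $\xi$-projective objects. Assume: - (WIC) if $gf$ is an inflation then so is $f$, and if $gf$ is a deflation then so is $g$; - $\mathcal C$ has arbitrary (set-indexed) coproducts; - $\mathcal C$ has enough $\xi$-projectives and enough $\xi$-injectives: for every object $A$ there are $\mathbb{E}$-triangles $K\to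 P\to A\dashrightarrow$ and $A\to I\to L\dashrightarrow$ in $\xi$ with $P$ $\xi$-projective and $I$ $\xi$-injective; - $\mathcal P(\xi)$ is generating: if $\mathcal C(P,A)=0$ for all $P\in\mathcal P(\xi)$, then $A=0$. A $\xi$-projective resolution of $M$ consists of $\mathbb{E}$-triangles $K_{n+1}\to P_n\to K_n\dashrightarrow$ in $\xi$ ($n\ge 0$) with $P_n\in\mathcal P(\xi)$ and $K_0\cong M$; it gives a complex $\mathbf P=(\cdots\to P_1\to P_0)$, and $\xi\mathrm{xt}^n_\xi(M,N):=H^n(\mathcal C(\mathbf P,N))$. Write $\xi\text{-pd}\,T\le 1$ if $T\in\mathcal P(\xi)$ or there is an $\mathbb{E}$-triangle $K\to P\to T\dashrightarrow$ in $\xi$ with $K,P\in\mathcal P(\xi)$. For an object $T$ of $\mathcal C$, let $$T^{\perp}=\{Y\in\mathcal C\mid \xi\mathrm{xt}^1_\xi(T,Y)=0\},$$ let $\mathrm{Add}\,T$ be the class of direct summands of coproducts $T^{(\lambda)}$ of copies of $T$, and let $\mathrm{Pres}^1_{\mathcal P(\xi)}(\mathrm{Add}\,T)$ be the class of objects $M$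 for which there is an $\mathbb{E}$-triangle $K_1\to Y_0\to M\dashrightarrow$ in $\xi$ with $Y_0\in\mathrm{Add}\,T$. The object $T$ is called $\xi$-tilting if $T\ne 0$ and - (T1) $\xi\text{-pd}\,T\le 1$; - (T2) $\xi\mathrm{xt}^1_\xi(T,T^{(\lambda)})=0$ for every cardinal $\lambda$; - (T3) for every $P\in\mathcal P(\xi)$ there is an $\mathbb{E}$-triangle $P\to T_0\to T_1\dashrightarrow$ in $\xi$ with $T_0,T_1\in\mathrm{Add}\,T$. **Theorem.** For every object $T$ of $\mathcal C$ the following are equivalent: 1. $T$ is $\xi$-tilting; 2. $T^{\perp}=\mathrm{Pres}^1_{\mathcal P(\xi)}(\mathrm{Add}\,T)$. -/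

import Mathlib

open CategoryTheory CategoryTheory.Limits Opposite

universe w v u

namespace Extri

section Basic

variable {C : Type u} [Category.{v} C]

/-- The `E`-extensions `E(X, A)`, for a bifunctor `E : Cᵒᵖ × C → Ab` in curried form. -/
abbrev Ext (E : Cᵒᵖ ⥤ C ⥤ AddCommGrpCat.{w}) (X A : C) : Type w :=
  (E.obj (op X)).obj A

variable {E : Cᵒᵖ ⥤ C ⥤ AddCommGrpCat.{w}}

/-- `a_* δ` for `a : A ⟶ A'` and `δ ∈ E(X, A)`. -/
def push {X A A' : C} (a : A ⟶ A') (δ : Ext E X A) : Ext E X A' :=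
  (E.obj (op X)).map a δ

/-- `c^* δ` for `c : X' ⟶ X` and `δ ∈ E(X, A)`. -/
def pull {X X' A : C} (c : X' ⟶ X) (δ : Ext E X A) : Ext E X' A :=
  (E.map c.op).app A δ

/-- A sequence of morphisms `A ⟶ B ⟶ X` with fixed end terms `A` and `X`. -/
structure ThreeTerm (A X : C) where
  B : C
  x : A ⟶ B
  y : B ⟶ X

/-- Two sequences `A ⟶ B ⟶ X` and `A ⟶ B' ⟶ X` are equivalent if there is an isomorphism
`B ≅ B'` compatible with the identities of `A` and `X`. -/
def ThreeTerm.setoid (A X : C) : Setoid (ThreeTerm A X) where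
  r S S' := ∃ b : S.B ≅ S'.B, S.x ≫ b.hom = S'.x ∧ b.hom ≫ S'.y = S.y
  iseqv :=
    { refl := fun S => ⟨Iso.refl _, by simp, by simp⟩
      symm := by
        rintro S S' ⟨b, h₁, h₂⟩
        exact ⟨b.symm, by simp [← h₁], by simp [← h₂]⟩
      trans := by
        rintro S S' S'' ⟨b, h₁, h₂⟩ ⟨b', h₁', h₂'⟩
        refine ⟨b ≪≫ b', ?_, ?_⟩
        · rw [Iso.trans_hom, ← Category.assoc, h₁, h₁']
        · rw [Iso.trans_hom, Category.assoc, h₂', h₂] }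

/-- A correspondence that associates to every `δ ∈ E(X, A)` an equivalence class of sequences
`A ⟶ B ⟶ X`. -/
abbrev Correspondence (E : Cᵒᵖ ⥤ C ⥤ AddCommGrpCat.{w}) : Type (max u v w) :=
  ∀ A X : C, Ext E X A → Quotient (ThreeTerm.setoid A X)

/-- The sequence `A ⟶ B ⟶ X` realizes `δ`, that is, `s(δ) = [A ⟶ B ⟶ X]`. -/
def Realizes (s : Correspondence E) {A B X : C} (x : A ⟶ B) (y : B ⟶ X) (δ : Ext E X A) : Prop :=
  s A X δ = Quotient.mk (ThreeTerm.setoid A X) ⟨B, x, y⟩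

/-- Condition (•): every morphism of extensions is realized by a morphism of sequences. -/
def IsRealization (s : Correspondence E) : Prop :=
  ∀ ⦃A B X A' B' X' : C⦄ ⦃x : A ⟶ B⦄ ⦃y : B ⟶ X⦄ ⦃x' : A' ⟶ B'⦄ ⦃y' : B' ⟶ X'⦄
    ⦃δ : Ext E X A⦄ ⦃δ' : Ext E X' A'⦄, Realizes s x y δ → Realizes s x' y' δ' →
    ∀ (a : A ⟶ A') (c : X ⟶ X'), push a δ = pull c δ' →
      ∃ b : B ⟶ B', x ≫ b = a ≫ x' ∧ y ≫ c = b ≫ y'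

/-- An `E`-triangle `A ⟶ B ⟶ X ⇢`. -/
structure ETriangle (s : Correspondence E) where
  {A B X : C}
  x : A ⟶ B
  y : B ⟶ X
  δ : Ext E X A
  realizes : Realizes s x y δ

/-- An inflation is the first morphism of an `E`-triangle. -/
def IsInflation (s : Correspondence E) {A B : C} (f : A ⟶ B) : Prop :=
  ∃ (X : C) (y : B ⟶ X) (δ : Ext E X A), Realizes s f y δ

/-- A deflation is the second morphism of an `E`-triangle. -/
def IsDeflation (s : Correspondence E) {B X : C} (g : B ⟶ X) : Prop :=
  ∃ (A : C) (x : A ⟶ B) (δ : Ext E X A), Realizes s x g δ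

/-- Condition (WIC). -/
structure WIC (s : Correspondence E) : Prop where
  inflation : ∀ ⦃X Y Z : C⦄ (f : X ⟶ Y) (g : Y ⟶ Z), IsInflation s (f ≫ g) → IsInflation s f
  deflation : ∀ ⦃X Y Z : C⦄ (f : X ⟶ Y) (g : Y ⟶ Z), IsDeflation s (f ≫ g) → IsDeflation s g

end Basic

section Additive

variable {C : Type u} [Category.{v} C] [Preadditive C] [HasBinaryBiproducts C]
variable {E : Cᵒᵖ ⥤ C ⥤ AddCommGrpCat.{w}}

/-- The direct sum `δ ⊕ δ' ∈ E(X ⊕ X', A ⊕ A')`: the element whose components in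
`E(X, A)`, `E(X, A')`, `E(X', A)`, `E(X', A')` are `δ`, `0`, `0`, `δ'`. -/
noncomputable def dsum {X A X' A' : C} (δ : Ext E X A) (δ' : Ext E X' A') :
    Ext E (X ⊞ X') (A ⊞ A') :=
  pull biprod.fst (push biprod.inl δ) + pull biprod.snd (push biprod.inr δ')

/-- `(C, E, s)` is an extriangulated category. -/
structure IsExtriangulated (s : Correspondence E) : Prop where
  /-- (ET1): `E` is additive in the first variable. -/
  additive_left : E.Additive
  /-- (ET1): `E` is additive in the second variable. -/
  additive_right : ∀ X : Cᵒᵖ, (E.obj X).Additive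
  /-- (ET2): `s` is a realization. -/
  realization : IsRealization s
  /-- (ET2): `s(0) = 0`. -/
  realizes_zero : ∀ A X : C,
    Realizes s (biprod.inl : A ⟶ A ⊞ X) (biprod.snd : A ⊞ X ⟶ X) (0 : Ext E X A)
  /-- (ET2): `s(δ ⊕ δ') = s(δ) ⊕ s(δ')`. -/
  realizes_dsum : ∀ ⦃A B X A' B' X' : C⦄ ⦃x : A ⟶ B⦄ ⦃y : B ⟶ X⦄ ⦃x' : A' ⟶ B'⦄ ⦃y' : B' ⟶ X'⦄
    ⦃δ : Ext E X A⦄ ⦃δ' : Ext E X' A'⦄, Realizes s x y δ → Realizes s x' y' δ' →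
    Realizes s (biprod.map x x') (biprod.map y y') (dsum δ δ')
  et3 : ∀ ⦃A B X A' B' X' : C⦄ ⦃x : A ⟶ B⦄ ⦃y : B ⟶ X⦄ ⦃x' : A' ⟶ B'⦄ ⦃y' : B' ⟶ X'⦄
    ⦃δ : Ext E X A⦄ ⦃δ' : Ext E X' A'⦄, Realizes s x y δ → Realizes s x' y' δ' →
    ∀ (a : A ⟶ A') (b : B ⟶ B'), x ≫ b = a ≫ x' →
      ∃ c : X ⟶ X', y ≫ c = b ≫ y' ∧ push a δ = pull c δ'
  et3_op : ∀ ⦃A B X A' B' X' : C⦄ ⦃x : A ⟶ B⦄ ⦃y : B ⟶ X⦄ ⦃x' : A' ⟶ B'⦄ ⦃y' : B' ⟶ X'⦄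
    ⦃δ : Ext E X A⦄ ⦃δ' : Ext E X' A'⦄, Realizes s x y δ → Realizes s x' y' δ' →
    ∀ (b : B ⟶ B') (c : X ⟶ X'), y ≫ c = b ≫ y' →
      ∃ a : A ⟶ A', x ≫ b = a ≫ x' ∧ push a δ = pull c δ'
  et4 : ∀ ⦃A B D X F : C⦄ ⦃f : A ⟶ B⦄ ⦃f' : B ⟶ D⦄ ⦃g : B ⟶ X⦄ ⦃g' : X ⟶ F⦄
    ⦃δ : Ext E D A⦄ ⦃δ' : Ext E F B⦄, Realizes s f f' δ → Realizes s g g' δ' →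
    ∃ (Y : C) (d : D ⟶ Y) (e : Y ⟶ F) (h : A ⟶ X) (h' : X ⟶ Y) (δ'' : Ext E Y A),
      Realizes s h h' δ'' ∧ f ≫ g = h ∧ f' ≫ d = g ≫ h' ∧ h' ≫ e = g' ∧
      Realizes s d e (push f' δ') ∧ pull d δ'' = δ ∧ push f δ'' = pull e δ'
  et4_op : ∀ ⦃D A B F X : C⦄ ⦃f' : D ⟶ A⦄ ⦃f : A ⟶ B⦄ ⦃g' : F ⟶ B⦄ ⦃g : B ⟶ X⦄
    ⦃δ : Ext E B D⦄ ⦃δ' : Ext E X F⦄, Realizes s f' f δ → Realizes s g' g δ' →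
    ∃ (Y : C) (d : D ⟶ Y) (e : Y ⟶ F) (h' : Y ⟶ A) (h : A ⟶ X) (δ'' : Ext E X Y),
      Realizes s h' h δ'' ∧ f ≫ g = h ∧ d ≫ h' = f' ∧ e ≫ g' = h' ≫ f ∧
      Realizes s d e (pull g' δ) ∧ push e δ'' = δ' ∧ push d δ = pull g δ''

variable {s : Correspondence E}

/-- `ξ` is a proper class of `E`-triangles. -/
structure IsProperClass (ξ : Set (ETriangle s)) : Prop where
  /-- `ξ` is closed under isomorphisms of `E`-triangles. -/
  iso_closed : ∀ (t t' : ETriangle s) (a : t.A ≅ t'.A) (b : t.B ≅ t'.B) (c : t.X ≅ t'.X),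
    t.x ≫ b.hom = a.hom ≫ t'.x → t.y ≫ c.hom = b.hom ≫ t'.y →
    push a.hom t.δ = pull c.hom t'.δ → t ∈ ξ → t' ∈ ξ
  /-- `ξ` is closed under finite coproducts (the empty one is a split `E`-triangle). -/
  dsum_mem : ∀ t t' : ETriangle s, t ∈ ξ → t' ∈ ξ →
    ∀ h : Realizes s (biprod.map t.x t'.x) (biprod.map t.y t'.y) (dsum t.δ t'.δ),
      (⟨_, _, _, h⟩ : ETriangle s) ∈ ξ
  /-- `ξ` contains all split `E`-triangles. -/
  split_mem : ∀ t : ETriangle s, t.δ = 0 → t ∈ ξ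
  base_change : ∀ t ∈ ξ, ∀ ⦃B' X' : C⦄ (c : X' ⟶ t.X) (x' : t.A ⟶ B') (y' : B' ⟶ X')
    (h : Realizes s x' y' (pull c t.δ)), (⟨x', y', _, h⟩ : ETriangle s) ∈ ξ
  cobase_change : ∀ t ∈ ξ, ∀ ⦃A' B' : C⦄ (a : t.A ⟶ A') (x' : A' ⟶ B') (y' : B' ⟶ t.X)
    (h : Realizes s x' y' (push a t.δ)), (⟨x', y', _, h⟩ : ETriangle s) ∈ ξ
  /-- `ξ` is saturated: for `E`-triangles `A₁ ⟶ B₁ ⟶ X` (with class `δ₁`) and `A₂ ⟶ B₂ ⟶ X`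
  (second morphism `y₂`), if the latter and `A₁ ⟶ M ⟶ B₂` with class `y₂^* δ₁` belong to `ξ`,
  then the former belongs to `ξ`. -/
  saturated : ∀ ⦃A₁ B₁ A₂ B₂ X M : C⦄
    (x₁ : A₁ ⟶ B₁) (y₁ : B₁ ⟶ X) (δ₁ : Ext E X A₁) (h₁ : Realizes s x₁ y₁ δ₁)
    (x₂ : A₂ ⟶ B₂) (y₂ : B₂ ⟶ X) (δ₂ : Ext E X A₂) (h₂ : Realizes s x₂ y₂ δ₂)
    (m₁ : A₁ ⟶ M) (e₁ : M ⟶ B₂) (h : Realizes s m₁ e₁ (pull y₂ δ₁)),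
    (⟨x₂, y₂, δ₂, h₂⟩ : ETriangle s) ∈ ξ → (⟨m₁, e₁, _, h⟩ : ETriangle s) ∈ ξ →
    (⟨x₁, y₁, δ₁, h₁⟩ : ETriangle s) ∈ ξ

end Additive

section Homological

variable {C : Type u} [Category.{v} C] [Preadditive C]
variable {E : Cᵒᵖ ⥤ C ⥤ AddCommGrpCat.{w}} {s : Correspondence E}

/-- `P` is `ξ`-projective: `0 ⟶ C(P, A) ⟶ C(P, B) ⟶ C(P, X) ⟶ 0` is exact for every
`E`-triangle in `ξ`. -/
def IsXiProjective (ξ : Set (ETriangle s)) (P : C) : Prop :=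
  ∀ t ∈ ξ, Function.Injective (fun f : P ⟶ t.A => f ≫ t.x) ∧
    Function.Exact (fun f : P ⟶ t.A => f ≫ t.x) (fun f : P ⟶ t.B => f ≫ t.y) ∧
    Function.Surjective (fun f : P ⟶ t.B => f ≫ t.y)

/-- `I` is `ξ`-injective: `0 ⟶ C(X, I) ⟶ C(B, I) ⟶ C(A, I) ⟶ 0` is exact for every
`E`-triangle in `ξ`. -/
def IsXiInjective (ξ : Set (ETriangle s)) (I : C) : Prop :=
  ∀ t ∈ ξ, Function.Injective (fun f : t.X ⟶ I => t.y ≫ f) ∧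
    Function.Exact (fun f : t.X ⟶ I => t.y ≫ f) (fun f : t.B ⟶ I => t.x ≫ f) ∧
    Function.Surjective (fun f : t.B ⟶ I => t.x ≫ f)

/-- The sequence `A ⟶ B ⟶ X` is part of an `E`-triangle in `ξ`. -/
def InXi (ξ : Set (ETriangle s)) {A B X : C} (x : A ⟶ B) (y : B ⟶ X) : Prop :=
  ∃ (δ : Ext E X A) (h : Realizes s x y δ), (⟨x, y, δ, h⟩ : ETriangle s) ∈ ξ

def EnoughXiProjectives (ξ : Set (ETriangle s)) : Prop :=
  ∀ A : C, ∃ (K P : C) (x : K ⟶ P) (y : P ⟶ A), InXi ξ x y ∧ IsXiProjective ξ P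

def EnoughXiInjectives (ξ : Set (ETriangle s)) : Prop :=
  ∀ A : C, ∃ (I K : C) (x : A ⟶ I) (y : I ⟶ K), InXi ξ x y ∧ IsXiInjective ξ I

/-- The `ξ`-projectives generate: an object that receives only zero morphisms from
`ξ`-projective objects is a zero object. -/
def XiProjectivesGenerate (ξ : Set (ETriangle s)) : Prop :=
  ∀ A : C, (∀ P : C, IsXiProjective ξ P → ∀ f : P ⟶ A, f = 0) → IsZero A

/-- `ξ`-pd `A` is at most `n`. -/
def XiPdLE (ξ : Set (ETriangle s)) : ℕ → C → Prop
  | 0, A => IsXiProjective ξ A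
  | n + 1, A => IsXiProjective ξ A ∨
      ∃ (K P : C) (x : K ⟶ P) (y : P ⟶ A), InXi ξ x y ∧ IsXiProjective ξ P ∧ XiPdLE ξ n K

/-- A `ξ`-projective resolution `⋯ ⟶ P₁ ⟶ P₀ ⟶ M ⟶ 0`, given by `E`-triangles
`K (n + 1) ⟶ P n ⟶ K n` in `ξ` with `K 0 ≅ M`. -/
structure XiProjRes (ξ : Set (ETriangle s)) (M : C) where
  P : ℕ → C
  K : ℕ → C
  g : ∀ n, K (n + 1) ⟶ P n
  f : ∀ n, P n ⟶ K n
  inXi : ∀ n, InXi ξ (g n) (f n)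
  proj : ∀ n, IsXiProjective ξ (P n)
  ε : K 0 ≅ M

namespace XiProjRes

variable {ξ : Set (ETriangle s)} {M : C} (R : XiProjRes ξ M) (N : C)

/-- The differential `P (n + 1) ⟶ P n`. -/
def d (n : ℕ) : R.P (n + 1) ⟶ R.P n := R.f (n + 1) ≫ R.g n

/-- The differential `C(P n, N) ⟶ C(P (n + 1), N)` of the complex `C(P, N)`. -/
def coboundaryMap (n : ℕ) : (R.P n ⟶ N) →+ (R.P (n + 1) ⟶ N) where
  toFun φ := R.d n ≫ φ
  map_zero' := comp_zero
  map_add' _ _ := Preadditive.comp_add _ _ _ _ _ _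

def cocycles (n : ℕ) : AddSubgroup (R.P n ⟶ N) := (R.coboundaryMap N n).ker

def coboundaries : ∀ n : ℕ, AddSubgroup (R.P n ⟶ N)
  | 0 => ⊥
  | n + 1 => (R.coboundaryMap N n).range

/-- The cohomology group `Hⁿ(C(P, N))`. -/
abbrev cohomology (n : ℕ) : Type v :=
  R.cocycles N n ⧸ (R.coboundaries N n).addSubgroupOf (R.cocycles N n)

end XiProjRes

theorem exists_xiProjRes {ξ : Set (ETriangle s)} (hP : EnoughXiProjectives ξ) (M : C) :
    Nonempty (XiProjRes ξ M) := by
  choose K P x y hxy hproj using hP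
  let S : ℕ → C := fun n => Nat.rec M (fun _ A => K A) n
  exact ⟨{ P := fun n => P (S n), K := S, g := fun n => x (S n), f := fun n => y (S n),
           inXi := fun n => hxy (S n), proj := fun n => hproj (S n), ε := Iso.refl M }⟩

/-- The `ξ`-cohomology group `ξxtⁿ(M, N)`, computed by a chosen `ξ`-projective resolution
of `M`. -/
abbrev XiExt (ξ : Set (ETriangle s)) (hP : EnoughXiProjectives ξ) (n : ℕ) (M N : C) : Type v :=
  (Classical.choice (exists_xiProjRes hP M)).cohomology N n

/-- `𝒳^⊥`, the objects `Y` with `ξxt¹(X, Y) = 0` for all `X ∈ 𝒳`. -/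
def rightPerp (ξ : Set (ETriangle s)) (hP : EnoughXiProjectives ξ) (𝒳 : Set C) : Set C :=
  {Y | ∀ X ∈ 𝒳, Subsingleton (XiExt ξ hP 1 X Y)}

/-- `Pres¹(𝒴)`, the objects `M` admitting an `E`-triangle `K₁ ⟶ Y₀ ⟶ M ⇢` in `ξ` with
`Y₀ ∈ 𝒴`. -/
def Pres1 (ξ : Set (ETriangle s)) (𝒴 : Set C) : Set C :=
  {M | ∃ (K₁ Y₀ : C) (x : K₁ ⟶ Y₀) (y : Y₀ ⟶ M), InXi ξ x y ∧ Y₀ ∈ 𝒴}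

/-- `Add 𝒳`, the direct summands of (set-indexed) direct sums of objects in `𝒳`. -/
def Add [HasBinaryBiproducts C] [HasCoproducts.{v} C] (𝒳 : Set C) : Set C :=
  {Y | ∃ (ι : Type v) (F : ι → C) (Y' : C), (∀ i, F i ∈ 𝒳) ∧ Nonempty (Y ⊞ Y' ≅ ∐ F)}

/-- `T` is a `ξ`-tilting object. -/
structure IsXiTilting [HasBinaryBiproducts C] [HasCoproducts.{v} C] (ξ : Set (ETriangle s))
    (hP : EnoughXiProjectives ξ) (T : C) : Prop where
  nonzero : ¬ IsZero T
  /-- (T1): `ξ`-pd `T ≤ 1`. -/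
  pd_le : XiPdLE ξ 1 T
  /-- (T2): `ξxt¹(T, T^(ι)) = 0` for every index set `ι`. -/
  ext_zero : ∀ ι : Type v, Subsingleton (XiExt ξ hP 1 T (∐ fun _ : ι => T))
  /-- (T3): every `ξ`-projective has an `Add T`-coresolution of length one in `ξ`. -/
  coresolution : ∀ P : C, IsXiProjective ξ P →
    ∃ (T₀ T₁ : C) (x : P ⟶ T₀) (y : T₀ ⟶ T₁), InXi ξ x y ∧ T₀ ∈ Add {T} ∧ T₁ ∈ Add {T}

end Homological

end Extri

/-! Everything is reduced to extending maps. If `K ⟶ P ⟶ T` is a resolution of length one, then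
`ξxt¹(T, N) = 0` iff every `K ⟶ N` extends to `P` (`subsingleton_xiExt_one_iff`). In that case all
extensions in `ξ` of `T`, hence of objects of `Add T`, by `N` split. Deflations in `ξ` are
recognized by lifting maps from `ξ`-projectives, through (WIC) and saturation.

If `T` is tilting and `M ∈ T^⊥`, a deflation `Q ⟶ M` in `ξ` with `Q` projective extends along `Q ⟶
T₀` from (T3), and the extension `T₀ ⟶ M` is again a deflation in `ξ`. Conversely, for a deflation
`Y ⟶ M` in `ξ` with `Y ∈ Add T`, a map `K ⟶ M` lifts to `Y` and extends by (T2).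

If `T^⊥ = Pres¹(Add T)`, then (T2) is immediate. Injectives lie in `T^⊥`, and `Pres¹` is closed
under quotients in `ξ`, so `T^⊥` contains all first cosyzygies. Dimension shifting then splits the
second step of a resolution of `T`, which is (T1); the obstruction to this is an idempotent, removed
by `eq_zero_of_idempotent`. For (T3), a universal extension `P ⟶ B ⟶ T^(λ)` has `B ∈ T^⊥`, and the
canonical map from copies of `T` onto `B` splits. -/

namespace Extri

/-! ### Functoriality of extensions. -/

section Functoriality

variable {C : Type u} [Category.{v} C] {E : Cᵒᵖ ⥤ C ⥤ AddCommGrpCat.{w}}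

theorem push_zero {X A A' : C} (a : A ⟶ A') : push a (0 : Ext E X A) = 0 :=
  map_zero ((E.obj (op X)).map a).hom

theorem pull_zero {X X' A : C} (c : X' ⟶ X) : pull c (0 : Ext E X A) = 0 :=
  map_zero ((E.map c.op).app A).hom

theorem push_id {X A : C} (δ : Ext E X A) : push (𝟙 A) δ = δ := by
  simp [push]

theorem pull_id {X A : C} (δ : Ext E X A) : pull (𝟙 X) δ = δ := by
  simp [pull]

theorem push_comp {X A A' A'' : C} (a : A ⟶ A') (a' : A' ⟶ A'') (δ : Ext E X A) :
    push (a ≫ a') δ = push a' (push a δ) := by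
  simp [push]

theorem pull_comp {X X' X'' A : C} (c' : X'' ⟶ X') (c : X' ⟶ X) (δ : Ext E X A) :
    pull (c' ≫ c) δ = pull c' (pull c δ) := by
  simp [pull]

theorem push_pull {X X' A A' : C} (a : A ⟶ A') (c : X' ⟶ X) (δ : Ext E X A) :
    push a (pull c δ) = pull c (push a δ) :=
  (ConcreteCategory.congr_hom ((E.map c.op).naturality a) δ).symm

theorem exists_realizes (s : Correspondence E) {X A : C} (δ : Ext E X A) :
    ∃ (B : C) (x : A ⟶ B) (y : B ⟶ X), Realizes s x y δ := by
  obtain ⟨⟨B, x, y⟩, h⟩ := Quotient.exists_rep (s A X δ)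
  exact ⟨B, x, y, h.symm⟩

end Functoriality

/-! ### Exactness along an `E`-triangle, by comparison with split triangles. -/

section Exactness

variable {C : Type u} [Category.{v} C] [Preadditive C] [HasBinaryBiproducts C]
variable {E : Cᵒᵖ ⥤ C ⥤ AddCommGrpCat.{w}} {s : Correspondence E}
variable {A B X : C} {x : A ⟶ B} {y : B ⟶ X} {δ : Ext E X A}

open ZeroObject

namespace IsExtriangulated

/-- The middle term of a split `E`-triangle is the direct sum of the end terms. -/
theorem nonempty_iso_biprod (hs : IsExtriangulated s) (h : Realizes s x y δ) (hδ : δ = 0) :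
    Nonempty (B ≅ A ⊞ X) := by
  subst hδ
  obtain ⟨b, -, -⟩ := Quotient.exact (h.symm.trans (hs.realizes_zero A X))
  exact ⟨b⟩

variable [HasZeroObject C]

theorem comp_eq_zero (hs : IsExtriangulated s) (h : Realizes s x y δ) : x ≫ y = 0 := by
  obtain ⟨c, hc, -⟩ := hs.et3 (hs.realizes_zero A 0) h (𝟙 A) (biprod.fst ≫ x) (by simp)
  have := congrArg (fun f => biprod.inl ≫ f) hc
  simpa using this.symm

theorem exists_desc (hs : IsExtriangulated s) (h : Realizes s x y δ) {N : C} (f : B ⟶ N)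
    (hf : x ≫ f = 0) : ∃ k : X ⟶ N, f = y ≫ k := by
  obtain ⟨c, hc, -⟩ := hs.et3 h (hs.realizes_zero 0 N) 0 (f ≫ biprod.inr) (by simp [reassoc_of% hf])
  exact ⟨c, by simpa using hc.symm⟩

theorem exists_lift (hs : IsExtriangulated s) (h : Realizes s x y δ) {Z : C} (f : Z ⟶ B)
    (hf : f ≫ y = 0) : ∃ k : Z ⟶ A, f = k ≫ x := by
  obtain ⟨a, ha, -⟩ := hs.et3_op (hs.realizes_zero Z 0) h (biprod.fst ≫ f) 0 (by simp [hf])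
  exact ⟨a, by simpa using ha⟩

theorem push_inflation (hs : IsExtriangulated s) (h : Realizes s x y δ) : push x δ = 0 := by
  obtain ⟨c, -, hc⟩ := hs.et3 h (hs.realizes_zero B 0) x biprod.inl rfl
  rw [hc, pull_zero]

theorem pull_deflation (hs : IsExtriangulated s) (h : Realizes s x y δ) : pull y δ = 0 := by
  obtain ⟨a, -, ha⟩ := hs.et3_op (hs.realizes_zero 0 B) h biprod.snd y rfl
  rw [← ha, push_zero]

theorem push_eq_zero_iff (hs : IsExtriangulated s) (h : Realizes s x y δ) {N : C} (f : A ⟶ N) :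
    push f δ = 0 ↔ ∃ k : B ⟶ N, f = x ≫ k := by
  constructor
  · intro hf
    obtain ⟨b, hb, -⟩ := hs.realization h (hs.realizes_zero N 0) f 0 (by rw [hf, pull_zero])
    refine ⟨b ≫ biprod.fst, ?_⟩
    simp [reassoc_of% hb]
  · rintro ⟨k, rfl⟩
    rw [push_comp, hs.push_inflation h, push_zero]

theorem pull_eq_zero_iff (hs : IsExtriangulated s) (h : Realizes s x y δ) {Z : C} (f : Z ⟶ X) :
    pull f δ = 0 ↔ ∃ k : Z ⟶ B, f = k ≫ y := by
  constructor
  · intro hf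
    obtain ⟨b, -, hb⟩ := hs.realization (hs.realizes_zero 0 Z) h 0 f (by rw [hf, push_zero])
    refine ⟨biprod.inr ≫ b, ?_⟩
    simp [← hb]
  · rintro ⟨k, rfl⟩
    rw [pull_comp, hs.pull_deflation h, pull_zero]

/-- Two realizations of the same extension have middle terms that are retracts of each other. -/
theorem exists_retract_of_iso (hs : IsExtriangulated s) (h : Realizes s x y δ) {B' X' : C}
    {x' : A ⟶ B'} {y' : B' ⟶ X'} {δ' : Ext E X' A} (h' : Realizes s x' y' δ') (c : X' ≅ X)
    (hδ : δ' = pull c.hom δ) : ∃ (i : B' ⟶ B) (r : B ⟶ B'), i ≫ r = 𝟙 B' := by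
  obtain ⟨b, hb, hb'⟩ := hs.realization h' h (𝟙 A) c.hom (by rw [push_id, hδ])
  obtain ⟨d, hd, hd'⟩ := hs.realization h h' (𝟙 A) c.inv
    (by rw [push_id, hδ, ← pull_comp, c.inv_hom_id, pull_id])
  have h₁ : x' ≫ (b ≫ d - 𝟙 B') = 0 := by
    simp [reassoc_of% hb, hd]
  have h₂ : (b ≫ d - 𝟙 B') ≫ y' = 0 := by
    simp [← hd', ← reassoc_of% hb']
  obtain ⟨k, hk⟩ := hs.exists_desc h' _ h₁
  have hn : (b ≫ d - 𝟙 B') ≫ (b ≫ d - 𝟙 B') = 0 := by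
    nth_rewrite 2 [hk]
    rw [reassoc_of% h₂, zero_comp]
  -- With `n = b ≫ d - 𝟙` and `n ≫ n = 0`, the inverse of `b ≫ d = 𝟙 + n` is `𝟙 - n`.
  refine ⟨b, d ≫ (𝟙 B' - (b ≫ d - 𝟙 B')), ?_⟩
  have hbd : b ≫ d = 𝟙 B' + (b ≫ d - 𝟙 B') := by abel
  rw [← Category.assoc]
  generalize b ≫ d - 𝟙 B' = n at *
  rw [hbd]
  simp [Preadditive.add_comp, Preadditive.comp_sub, hn]

end IsExtriangulated

end Exactness

/-! ### Projectives, deflations in a proper class, and vanishing idempotents. -/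

section ProperClass

variable {C : Type u} [Category.{v} C] [Preadditive C]
variable {E : Cᵒᵖ ⥤ C ⥤ AddCommGrpCat.{w}} {s : Correspondence E} {ξ : Set (ETriangle s)}

/-- Inflations need not be monomorphisms; those in `ξ` can still be cancelled after maps from
`ξ`-projectives. -/
theorem IsXiProjective.eq_zero_of_comp {P : C} (hP : IsXiProjective ξ P) {A B X : C} {x : A ⟶ B}
    {y : B ⟶ X} (h : InXi ξ x y) {f : P ⟶ A} (hf : f ≫ x = 0) : f = 0 := by
  obtain ⟨δ, h, ht⟩ := h
  exact (hP _ ht).1 (by simpa using hf)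

theorem IsXiProjective.exists_lift {P : C} (hP : IsXiProjective ξ P) {A B X : C} {x : A ⟶ B}
    {y : B ⟶ X} (h : InXi ξ x y) (f : P ⟶ X) : ∃ k : P ⟶ B, f = k ≫ y := by
  obtain ⟨δ, h, ht⟩ := h
  obtain ⟨k, hk⟩ := (hP _ ht).2.2 f
  exact ⟨k, hk.symm⟩

theorem IsXiInjective.eq_zero_of_comp {I : C} (hI : IsXiInjective ξ I) {A B X : C} {x : A ⟶ B}
    {y : B ⟶ X} (h : InXi ξ x y) {f : X ⟶ I} (hf : y ≫ f = 0) : f = 0 := by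
  obtain ⟨δ, h, ht⟩ := h
  exact (hI _ ht).1 (by simpa using hf)

theorem IsXiInjective.exists_extension {I : C} (hI : IsXiInjective ξ I) {A B X : C} {x : A ⟶ B}
    {y : B ⟶ X} (h : InXi ξ x y) (f : A ⟶ I) : ∃ k : B ⟶ I, f = x ≫ k := by
  obtain ⟨δ, h, ht⟩ := h
  obtain ⟨k, hk⟩ := (hI _ ht).2.2 f
  exact ⟨k, hk.symm⟩

theorem IsXiProjective.of_isZero {P : C} (hP : IsZero P) : IsXiProjective ξ P := by
  intro t ht
  exact ⟨fun _ _ _ => hP.eq_of_src _ _, fun _ => ⟨fun _ => ⟨0, hP.eq_of_src _ _⟩,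
    fun _ => hP.eq_of_src _ _⟩, fun _ => ⟨0, hP.eq_of_src _ _⟩⟩

variable [HasBinaryBiproducts C]

/-- The extension `δ` is realized by an `E`-triangle in `ξ`. -/
def MemXi (ξ : Set (ETriangle s)) {X A : C} (δ : Ext E X A) : Prop :=
  ∃ (B : C) (x : A ⟶ B) (y : B ⟶ X) (h : Realizes s x y δ), (⟨x, y, δ, h⟩ : ETriangle s) ∈ ξ

theorem MemXi.push (hξ : IsProperClass ξ) {X A A' : C} {δ : Ext E X A} (hδ : MemXi ξ δ)
    (a : A ⟶ A') : MemXi ξ (push a δ) := by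
  obtain ⟨B, x, y, h, ht⟩ := hδ
  obtain ⟨B', x', y', h'⟩ := exists_realizes s (Extri.push a δ)
  exact ⟨B', x', y', h', hξ.cobase_change _ ht a x' y' h'⟩

theorem MemXi.pull (hξ : IsProperClass ξ) {X X' A : C} {δ : Ext E X A} (hδ : MemXi ξ δ)
    (c : X' ⟶ X) : MemXi ξ (pull c δ) := by
  obtain ⟨B, x, y, h, ht⟩ := hδ
  obtain ⟨B', x', y', h'⟩ := exists_realizes s (Extri.pull c δ)
  exact ⟨B', x', y', h', hξ.base_change _ ht c x' y' h'⟩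

variable [HasZeroObject C]

theorem IsXiProjective.of_retract (hs : IsExtriangulated s) {P Q : C} (hP : IsXiProjective ξ P)
    (i : Q ⟶ P) (r : P ⟶ Q) (h : i ≫ r = 𝟙 Q) : IsXiProjective ξ Q := by
  intro t ht
  refine ⟨fun f g hfg => ?_, fun f => ⟨fun hf => ?_, ?_⟩, fun f => ?_⟩
  · have := (hP t ht).1 (a₁ := r ≫ f) (a₂ := r ≫ g) (by simpa using congrArg (r ≫ ·) hfg)
    simpa [reassoc_of% h] using congrArg (i ≫ ·) this
  · obtain ⟨k, hk⟩ := hs.exists_lift t.realizes f hf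
    exact ⟨k, hk.symm⟩
  · rintro ⟨k, rfl⟩
    simp [hs.comp_eq_zero t.realizes]
  · obtain ⟨k, hk⟩ := (hP t ht).2.2 (r ≫ f)
    refine ⟨i ≫ k, ?_⟩
    simp only at hk
    simp [hk, reassoc_of% h]

/-- If a deflation in `ξ` factors through `g`, then `g` is a deflation in `ξ`. -/
theorem exists_inXi_of_factorization (hs : IsExtriangulated s) (hWIC : WIC s)
    (hξ : IsProperClass ξ) {K P B M : C} {x : K ⟶ P} {y : P ⟶ M} (h : InXi ξ x y)
    (l : P ⟶ B) (g : B ⟶ M) (hy : y = l ≫ g) : ∃ (A : C) (k : A ⟶ B), InXi ξ k g := by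
  obtain ⟨δ, hr, ht⟩ := h
  obtain ⟨A, k, η, hη⟩ := hWIC.deflation l g (hy ▸ ⟨K, x, δ, hr⟩)
  obtain ⟨N, m, e, hm⟩ := exists_realizes s (pull y η)
  -- The class of `g` pulls back to zero along `y`, because `y` factors through `g`; split triangles
  -- lie in `ξ`, so saturation applies.
  exact ⟨A, k, η, hη, hξ.saturated k g η hη x y δ hr m e hm ht
    (hξ.split_mem _ ((hs.pull_eq_zero_iff hη y).2 ⟨l, hy⟩))⟩

/-- A morphism through which all morphisms from `ξ`-projectives factor is a deflation in `ξ`. -/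
theorem exists_inXi_of_lifting (hs : IsExtriangulated s) (hWIC : WIC s)
    (hξ : IsProperClass ξ) (hP : EnoughXiProjectives ξ) {B M : C} (g : B ⟶ M)
    (hg : ∀ P, IsXiProjective ξ P → ∀ f : P ⟶ M, ∃ l : P ⟶ B, f = l ≫ g) :
    ∃ (A : C) (k : A ⟶ B), InXi ξ k g := by
  obtain ⟨K, P, x, y, h, hPP⟩ := hP M
  obtain ⟨l, hl⟩ := hg P hPP y
  exact exists_inXi_of_factorization hs hWIC hξ h l g hl

theorem exists_inXi_id (hs : IsExtriangulated s) (hWIC : WIC s)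
    (hξ : IsProperClass ξ) (hP : EnoughXiProjectives ξ) (M : C) :
    ∃ (A : C) (k : A ⟶ M), InXi ξ k (𝟙 M) :=
  exists_inXi_of_lifting hs hWIC hξ hP (𝟙 M) fun _ _ f => ⟨f, by simp⟩

/-- An idempotent that kills all morphisms from `ξ`-projective objects vanishes: it splits in the
presence of countable coproducts, and its image receives only zero morphisms from
`ξ`-projectives. -/
theorem eq_zero_of_idempotent [HasCoproducts.{v} C] (hs : IsExtriangulated s) (hWIC : WIC s)
    (hξ : IsProperClass ξ) (hP : EnoughXiProjectives ξ) (hgen : XiProjectivesGenerate ξ)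
    {X : C} (p : X ⟶ X) (hp : p ≫ p = p)
    (h : ∀ P, IsXiProjective ξ P → ∀ f : P ⟶ X, f ≫ p = 0) : p = 0 := by
  -- An Eilenberg swindle on countably many copies of `X`: `σ` moves the `p`-part one copy up and
  -- fixes the `(𝟙 - p)`-part, while `r` moves the `p`-part one copy down and kills it in copy `0`.
  -- So `σ` is a section of `r`, and the kernel of `r` is the image of `p` in copy `0`.
  let F : ULift.{v} ℕ → C := fun _ => X
  let ι : ℕ → (X ⟶ ∐ F) := fun n => Sigma.ι F ⟨n⟩
  let r : ∐ F ⟶ ∐ F := Sigma.desc fun n =>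
    Nat.casesOn (motive := fun _ => X ⟶ ∐ F) n.down ((𝟙 X - p) ≫ ι 0)
      (fun m => p ≫ ι m + (𝟙 X - p) ≫ ι (m + 1))
  let σ : ∐ F ⟶ ∐ F := Sigma.desc fun n => p ≫ ι (n.down + 1) + (𝟙 X - p) ≫ ι n.down
  let π : ∐ F ⟶ X := Sigma.desc fun n =>
    Nat.casesOn (motive := fun _ => X ⟶ X) n.down (𝟙 X) (fun _ => 0)
  have hr0 : ι 0 ≫ r = (𝟙 X - p) ≫ ι 0 := by simp [ι, r]
  have hr (n : ℕ) : ι (n + 1) ≫ r = p ≫ ι n + (𝟙 X - p) ≫ ι (n + 1) := by simp [ι, r]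
  have hσ (n : ℕ) : ι n ≫ σ = p ≫ ι (n + 1) + (𝟙 X - p) ≫ ι n := by simp [ι, σ]
  have hπ0 : ι 0 ≫ π = 𝟙 X := by simp [ι, π]
  have hπ (n : ℕ) : ι (n + 1) ≫ π = 0 := by simp [ι, π]
  have hp₁ {Z : C} (f : X ⟶ Z) : p ≫ p ≫ f = p ≫ f := by rw [reassoc_of% hp]
  have hσr : σ ≫ r = 𝟙 (∐ F) := by
    refine Sigma.hom_ext _ _ ?_
    rintro ⟨_ | n⟩
    · change ι 0 ≫ σ ≫ r = ι 0 ≫ 𝟙 _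
      simp [reassoc_of% (hσ 0), hr, hr0, Preadditive.comp_sub, Preadditive.sub_comp, hp₁]
    · change ι (n + 1) ≫ σ ≫ r = ι (n + 1) ≫ 𝟙 _
      simp [reassoc_of% (hσ (n + 1)), hr, Preadditive.comp_sub, Preadditive.sub_comp, hp₁]
  have hrσ : 𝟙 (∐ F) - r ≫ σ = π ≫ p ≫ ι 0 := by
    refine Sigma.hom_ext _ _ ?_
    rintro ⟨_ | n⟩
    · change ι 0 ≫ _ = ι 0 ≫ _
      simp [reassoc_of% hr0, reassoc_of% hπ0, hσ, Preadditive.comp_sub, Preadditive.sub_comp, hp₁]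
    · change ι (n + 1) ≫ _ = ι (n + 1) ≫ _
      simp [reassoc_of% (hr n), reassoc_of% (hπ n), hσ, Preadditive.comp_sub,
        Preadditive.sub_comp, hp₁]
  obtain ⟨A, k, δ, hδ, -⟩ := exists_inXi_of_lifting hs hWIC hξ hP r
    fun _ _ f => ⟨f ≫ σ, by simp [hσr]⟩
  have hδ0 : δ = 0 := by
    rw [← pull_id δ, hs.pull_eq_zero_iff hδ]
    exact ⟨σ, hσr.symm⟩
  obtain ⟨ρ, hρ⟩ := (hs.push_eq_zero_iff hδ (𝟙 A)).1 (by rw [hδ0, push_zero])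
  have hkr := hs.comp_eq_zero hδ
  -- The inclusion `k` factors through `p`, which kills maps from `ξ`-projectives, and `k` has the
  -- retraction `ρ`.
  have hA : IsZero A := hgen A fun P hPP f => by
    have h₁ : k = k ≫ π ≫ p ≫ ι 0 := by
      rw [← hrσ, Preadditive.comp_sub, reassoc_of% hkr]
      simp
    have h₂ : f ≫ k = 0 := by
      rw [h₁]
      have := h P hPP (f ≫ k ≫ π)
      simp only [Category.assoc] at this
      rw [reassoc_of% this, zero_comp]
    rw [← Category.comp_id f, hρ, reassoc_of% h₂, zero_comp]
  obtain ⟨m, hm⟩ := hs.exists_lift hδ (𝟙 (∐ F) - r ≫ σ)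
    (by simp [Preadditive.sub_comp, hσr])
  rw [hrσ, hA.eq_of_src k 0, comp_zero] at hm
  have := congrArg (fun f => ι 0 ≫ f ≫ π) hm
  simpa [reassoc_of% hπ0, hπ0] using this

end ProperClass

/-! ### The first `ξ`-cohomology and `ξ`-projective dimension at most one. -/

section Cohomology

variable {C : Type u} [Category.{v} C] [Preadditive C]
variable {E : Cᵒᵖ ⥤ C ⥤ AddCommGrpCat.{w}} {s : Correspondence E} {ξ : Set (ETriangle s)}

theorem XiProjRes.subsingleton_cohomology_one_iff {M : C} (R : XiProjRes ξ M) (N : C) :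
    Subsingleton (R.cohomology N 1) ↔
      ∀ f : R.P 1 ⟶ N, R.d 1 ≫ f = 0 → ∃ k : R.P 0 ⟶ N, f = R.d 0 ≫ k := by
  rw [QuotientAddGroup.subsingleton_iff, AddSubgroup.addSubgroupOf_eq_top]
  constructor
  · intro h f hf
    obtain ⟨k, hk⟩ := h (x := f) hf
    exact ⟨k, hk.symm⟩
  · intro h f hf
    obtain ⟨k, hk⟩ := h f hf
    exact ⟨k, hk.symm⟩

theorem mem_rightPerp_singleton (hP : EnoughXiProjectives ξ) (T Y : C) :
    Y ∈ rightPerp ξ hP {T} ↔ Subsingleton (XiExt ξ hP 1 T Y) := by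
  simp [rightPerp]

variable [HasZeroObject C] [HasBinaryBiproducts C] {K P T : C} {x : K ⟶ P} {y : P ⟶ T}

/-- The obstruction to extending `f` is the pushforward of the class along `f`, again an extension
in `ξ`. -/
theorem exists_extension_of_memXi_eq_zero (hs : IsExtriangulated s) (hξ : IsProperClass ξ)
    {A B X N : C} {x : A ⟶ B} {y : B ⟶ X} (h : InXi ξ x y)
    (hN : ∀ δ : Ext E X N, MemXi ξ δ → δ = 0) (f : A ⟶ N) : ∃ k : B ⟶ N, f = x ≫ k := by
  obtain ⟨δ, hr, ht⟩ := h
  exact (hs.push_eq_zero_iff hr f).1 (hN _ (MemXi.push hξ ⟨_, _, _, hr, ht⟩ f))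

/-- As `P` is `ξ`-projective, every extension in `ξ` of `T` by `N` is a pushforward of the class of
`K ⟶ P ⟶ T` along some `K ⟶ N`. -/
theorem memXi_eq_zero_of_exists_extension (hs : IsExtriangulated s) (h : InXi ξ x y)
    (hP : IsXiProjective ξ P) {N : C} (hN : ∀ f : K ⟶ N, ∃ k : P ⟶ N, f = x ≫ k)
    (δ : Ext E T N) (hδ : MemXi ξ δ) : δ = 0 := by
  obtain ⟨B, n, z, hz, ht⟩ := hδ
  obtain ⟨l, hl⟩ := hP.exists_lift ⟨δ, hz, ht⟩ y
  obtain ⟨η, hη, -⟩ := h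
  obtain ⟨a, -, ha⟩ := hs.et3_op hη hz l (𝟙 T) (by simpa using hl)
  rw [← pull_id δ, ← ha, hs.push_eq_zero_iff hη]
  exact hN a

/-- The first `ξ`-cohomology of an object with a `ξ`-projective resolution of length one. -/
theorem subsingleton_xiExt_one_iff (hs : IsExtriangulated s) (hE : EnoughXiProjectives ξ)
    (h : InXi ξ x y) (hP : IsXiProjective ξ P) (hK : IsXiProjective ξ K) (N : C) :
    Subsingleton (XiExt ξ hE 1 T N) ↔ ∀ f : K ⟶ N, ∃ k : P ⟶ N, f = x ≫ k := by
  unfold XiExt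
  generalize Classical.choice (exists_xiProjRes hE T) = R
  rw [R.subsingleton_cohomology_one_iff]
  obtain ⟨η, hη, ht⟩ := h
  have h : InXi ξ x y := ⟨η, hη, ht⟩
  have hxy := hs.comp_eq_zero hη
  have hgf (n : ℕ) : R.g n ≫ R.f n = 0 := by
    obtain ⟨_, h', _⟩ := R.inXi n
    exact hs.comp_eq_zero h'
  have lift {n : ℕ} {Z : C} (f : Z ⟶ R.P n) (hf : f ≫ R.f n = 0) : ∃ k, f = k ≫ R.g n := by
    obtain ⟨_, h', _⟩ := R.inXi n
    exact hs.exists_lift h' f hf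
  -- Comparison maps over `T` in both directions: `a`, `α` from `R` to the short resolution, and
  -- `b`, `β'` back.
  obtain ⟨a, ha⟩ := (R.proj 0).exists_lift h (R.f 0 ≫ R.ε.hom)
  obtain ⟨b, hb⟩ := hP.exists_lift (R.inXi 0) (y ≫ R.ε.inv)
  obtain ⟨α, hα⟩ := hs.exists_lift hη (R.g 0 ≫ a) (by
    rw [Category.assoc, ← ha, reassoc_of% (hgf 0), zero_comp])
  obtain ⟨β, hβ⟩ := lift (x ≫ b) (by rw [Category.assoc, ← hb, reassoc_of% hxy, zero_comp])
  obtain ⟨β', hβ'⟩ := hK.exists_lift (R.inXi 1) β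
  subst hβ'
  constructor
  · intro H u
    obtain ⟨σ, hσ⟩ := hs.exists_lift hη (b ≫ a - 𝟙 P) (by
      rw [Preadditive.sub_comp, Category.assoc, ← ha, ← reassoc_of% hb]
      simp)
    -- The homotopy identity holds after composing with `x`, which cancels because `K` is
    -- `ξ`-projective.
    have hβα : (β' ≫ R.f 1) ≫ α - 𝟙 K = x ≫ σ := by
      rw [← sub_eq_zero]
      refine hK.eq_zero_of_comp h ?_
      simp only [Preadditive.sub_comp, Category.assoc, ← hα, ← hσ, Preadditive.comp_sub]
      rw [← Category.assoc β', ← Category.assoc, ← hβ]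
      simp
    obtain ⟨k, hk⟩ := H (R.f 1 ≫ α ≫ u) (by
      simp [XiProjRes.d, reassoc_of% (hgf 1)])
    refine ⟨b ≫ k - σ ≫ u, ?_⟩
    have h₁ := congrArg (· ≫ u) hβα
    have h₂ := congrArg (β' ≫ ·) hk
    simp only [XiProjRes.d, Preadditive.sub_comp, Category.assoc, Category.id_comp] at h₁ h₂
    rw [h₂] at h₁
    have h₃ := congrArg (· ≫ k) hβ
    simp only [Category.assoc] at h₃
    rw [← h₃] at h₁
    rw [Preadditive.comp_sub, ← h₁]
    abel
  · intro H v hv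
    obtain ⟨σ, hσ⟩ := lift (a ≫ b - 𝟙 (R.P 0)) (by
      rw [Preadditive.sub_comp, Category.assoc, ← hb, ← reassoc_of% ha]
      simp)
    obtain ⟨σ', hσ'⟩ := (R.proj 0).exists_lift (R.inXi 1) σ
    subst hσ'
    have h₁ : R.f 1 ≫ α ≫ β' ≫ R.f 1 - R.f 1 - R.f 1 ≫ R.g 0 ≫ σ' ≫ R.f 1 = 0 := by
      refine (R.proj 1).eq_zero_of_comp (R.inXi 0) ?_
      simp only [Category.assoc] at hσ hβ
      simp only [Preadditive.sub_comp, Category.assoc, ← hσ, ← hβ, Preadditive.comp_sub,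
        ← reassoc_of% hα]
      simp
    -- The error of the homotopy in degree one factors through `R.d 1`, so the cocycle `v` kills it.
    obtain ⟨w, hw⟩ := lift (R.f 1 ≫ α ≫ β' - 𝟙 (R.P 1) - R.f 1 ≫ R.g 0 ≫ σ') (by
      simpa [Preadditive.sub_comp] using h₁)
    obtain ⟨w', rfl⟩ := (R.proj 1).exists_lift (R.inXi 2) w
    obtain ⟨k, hk⟩ := H (β' ≫ v)
    refine ⟨a ≫ k - σ' ≫ v, ?_⟩
    have h₂ := congrArg (· ≫ v) hw
    simp only [XiProjRes.d, Preadditive.sub_comp, Category.assoc, Category.id_comp] at h₂ hv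
    rw [hv, comp_zero, hk, ← reassoc_of% hα] at h₂
    simp only [XiProjRes.d, Preadditive.comp_sub, Category.assoc]
    rw [sub_sub, sub_eq_zero] at h₂
    rw [h₂]
    abel

/-- A cocycle `P 1 ⟶ I` vanishes on `K 2`, since maps into `I` can be cancelled after `R.f 2`; it
therefore descends to `K 1` and extends to `P 0`. -/
theorem subsingleton_xiExt_one_of_isXiInjective (hs : IsExtriangulated s)
    (hE : EnoughXiProjectives ξ) {I : C} (hI : IsXiInjective ξ I) (M : C) :
    Subsingleton (XiExt ξ hE 1 M I) := by
  unfold XiExt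
  generalize Classical.choice (exists_xiProjRes hE M) = R
  rw [R.subsingleton_cohomology_one_iff]
  intro f hf
  have h₁ := hI.eq_zero_of_comp (R.inXi 2) (f := R.g 1 ≫ f) (by simpa [XiProjRes.d] using hf)
  obtain ⟨_, h', _⟩ := R.inXi 1
  obtain ⟨g, rfl⟩ := hs.exists_desc h' f h₁
  obtain ⟨k, rfl⟩ := hI.exists_extension (R.inXi 0) g
  exact ⟨k, by simp [XiProjRes.d]⟩

/-- An object of `ξ`-projective dimension at most one has a resolution of length one. -/
theorem XiPdLE.exists_resolution (hs : IsExtriangulated s) (hWIC : WIC s)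
    (hξ : IsProperClass ξ) (hE : EnoughXiProjectives ξ) (hgen : XiProjectivesGenerate ξ)
    (h : XiPdLE ξ 1 T) : ∃ (K P : C) (x : K ⟶ P) (y : P ⟶ T),
      InXi ξ x y ∧ IsXiProjective ξ P ∧ IsXiProjective ξ K := by
  rcases h with h | h
  · obtain ⟨A, k, hk⟩ := exists_inXi_id hs hWIC hξ hE T
    -- Since `k ≫ 𝟙 T = 0`, maps from `ξ`-projectives to `A` vanish, and generation gives `A = 0`.
    refine ⟨A, T, k, 𝟙 T, hk, h, IsXiProjective.of_isZero (hgen A fun P hP f => ?_)⟩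
    refine hP.eq_zero_of_comp hk ?_
    obtain ⟨δ, hr, -⟩ := hk
    rw [← Category.comp_id k, hs.comp_eq_zero hr, comp_zero]
  · exact h

/-- If the first `ξ`-cohomology of `T` vanishes on the third term of `ξ`-triangles whose second
term is `ξ`-injective, then `T` has `ξ`-projective dimension at most one. -/
theorem xiPdLE_one_of_subsingleton [HasCoproducts.{v} C] (hs : IsExtriangulated s) (hWIC : WIC s)
    (hξ : IsProperClass ξ) (hE : EnoughXiProjectives ξ) (hI : EnoughXiInjectives ξ)
    (hgen : XiProjectivesGenerate ξ) (T : C)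
    (h : ∀ (M I L : C) (i : M ⟶ I) (q : I ⟶ L), InXi ξ i q → IsXiInjective ξ I →
      Subsingleton (XiExt ξ hE 1 T L)) : XiPdLE ξ 1 T := by
  unfold XiExt at h
  generalize Classical.choice (exists_xiProjRes hE T) = R at h
  obtain ⟨δ₀, h₀, ht₀⟩ := R.inXi 0
  obtain ⟨δ₁, h₁, ht₁⟩ := R.inXi 1
  have hgf₀ := hs.comp_eq_zero h₀
  have hgf₁ := hs.comp_eq_zero h₁
  -- Dimension shifting for the second syzygy: `i` extends to `j` on `P 1`, and `j ≫ q` is a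
  -- cocycle, hence a coboundary. Correcting `j` by a lift of the bounding map gives `φ : P 1 ⟶ K 2`
  -- with `(R.g 1 ≫ φ) ≫ i = i`.
  obtain ⟨I, L, i, q, hiq, hInj⟩ := hI (R.K 2)
  have hL := (R.subsingleton_cohomology_one_iff L).1 (h _ _ _ i q hiq hInj)
  obtain ⟨δ, hδ, -⟩ := id hiq
  obtain ⟨j, hj⟩ := hInj.exists_extension (R.inXi 1) i
  obtain ⟨k, hk⟩ := hL (j ≫ q) (by
    rw [XiProjRes.d, Category.assoc, ← reassoc_of% hj, hs.comp_eq_zero hδ, comp_zero])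
  obtain ⟨k', rfl⟩ := (R.proj 0).exists_lift hiq k
  obtain ⟨φ, hφ⟩ := hs.exists_lift hδ (j - R.d 0 ≫ k') (by
    simp [Preadditive.sub_comp, hk])
  have hφ' : R.f 2 ≫ R.g 1 ≫ φ - R.f 2 = 0 := by
    refine (R.proj 2).eq_zero_of_comp hiq ?_
    simp only [Preadditive.sub_comp, Category.assoc, ← hφ, Preadditive.comp_sub, ← hj]
    simp [XiProjRes.d, reassoc_of% hgf₁]
  -- The inflation `i` cancels only on maps from `ξ`-projectives, so `𝟙 - R.g 1 ≫ φ` is so far only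
  -- known to kill these. Applied to `φ` itself, this makes it idempotent.
  have hker : ∀ Q, IsXiProjective ξ Q → ∀ f : Q ⟶ R.K 2, f ≫ (𝟙 _ - R.g 1 ≫ φ) = 0 := by
    intro Q hQ f
    obtain ⟨l, rfl⟩ := hQ.exists_lift (R.inXi 2) f
    have := congrArg (l ≫ ·) hφ'
    simp only [Preadditive.comp_sub, comp_zero] at this
    rw [Preadditive.comp_sub, Category.comp_id, ← neg_sub, Category.assoc, this, neg_zero]
  have hφφ := hker _ (R.proj 1) φ
  have hzero := eq_zero_of_idempotent hs hWIC hξ hE hgen (𝟙 _ - R.g 1 ≫ φ) (by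
    rw [Preadditive.sub_comp, Category.id_comp, Category.assoc, hφφ, comp_zero, sub_zero]) hker
  have hδ₁ : δ₁ = 0 := by
    rw [← push_id δ₁, hs.push_eq_zero_iff h₁]
    exact ⟨φ, sub_eq_zero.1 hzero⟩
  obtain ⟨r, hr⟩ := (hs.pull_eq_zero_iff h₁ (𝟙 _)).1 (by rw [hδ₁, pull_zero])
  have hK : IsXiProjective ξ (R.K 1) := (R.proj 1).of_retract hs r (R.f 1) hr.symm
  -- The triangle ends at `R.K 0`; pulling back along the isomorphism with `T` replaces `P 0` by a
  -- retract of it.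
  obtain ⟨B, x, y, hxy⟩ := exists_realizes s (pull R.ε.inv δ₀)
  obtain ⟨a, b, hab⟩ := hs.exists_retract_of_iso h₀ hxy R.ε.symm rfl
  exact Or.inr ⟨R.K 1, B, x, y, ⟨_, hxy, hξ.base_change _ ht₀ _ x y hxy⟩,
    (R.proj 0).of_retract hs a b hab, hK⟩

theorem add_subset_pres1 (hs : IsExtriangulated s) (hWIC : WIC s) (hξ : IsProperClass ξ)
    (hP : EnoughXiProjectives ξ) (𝒴 : Set C) : 𝒴 ⊆ Pres1 ξ 𝒴 := fun Y hY => by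
  obtain ⟨A, k, hk⟩ := exists_inXi_id hs hWIC hξ hP Y
  exact ⟨A, Y, k, 𝟙 Y, hk, hY⟩

/-- `Pres¹` is closed under deflations in `ξ`. -/
theorem mem_pres1_of_inXi (hs : IsExtriangulated s) (hWIC : WIC s) (hξ : IsProperClass ξ)
    (hP : EnoughXiProjectives ξ) {𝒴 : Set C} {M I L : C} {i : M ⟶ I} {q : I ⟶ L}
    (h : InXi ξ i q) (hI : I ∈ Pres1 ξ 𝒴) : L ∈ Pres1 ξ 𝒴 := by
  obtain ⟨K, Y, x, y, hxy, hY⟩ := hI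
  obtain ⟨A, k, hk⟩ := exists_inXi_of_lifting hs hWIC hξ hP (y ≫ q) fun Q hQ f => by
    obtain ⟨f', rfl⟩ := hQ.exists_lift h f
    obtain ⟨f'', rfl⟩ := hQ.exists_lift hxy f'
    exact ⟨f'', by simp⟩
  exact ⟨A, Y, k, _, hk, hY⟩

end Cohomology

/-! ### Both implications of the theorem. -/

section Tilting

variable {C : Type u} [Category.{v} C] [Preadditive C] [HasBinaryBiproducts C] [HasCoproducts.{v} C]
variable {E : Cᵒᵖ ⥤ C ⥤ AddCommGrpCat.{w}} {s : Correspondence E} {ξ : Set (ETriangle s)}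

theorem exists_retract_of_mem_add {T Y : C} (h : Y ∈ Add {T}) :
    ∃ (ι : Type v) (i : Y ⟶ ∐ fun _ : ι => T) (r : (∐ fun _ : ι => T) ⟶ Y), i ≫ r = 𝟙 Y := by
  obtain ⟨ι, F, Y', hF, ⟨e⟩⟩ := h
  obtain rfl : F = fun _ => T := funext hF
  exact ⟨ι, biprod.inl ≫ e.hom, e.inv ≫ biprod.fst, by simp⟩

variable [HasZeroObject C]

open ZeroObject in
theorem sigma_mem_add (T : C) (ι : Type v) : (∐ fun _ : ι => T) ∈ Add {T} :=
  ⟨ι, fun _ => T, 0, fun _ => rfl,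
    ⟨⟨biprod.fst, biprod.inl, by ext; simp, by simp⟩⟩⟩

/-- If all extensions in `ξ` of `T` by `N` split, then so do those of objects in `Add T`. -/
theorem memXi_eq_zero_of_mem_add (hs : IsExtriangulated s)
    (hI : EnoughXiInjectives ξ) {T N : C} (hN : ∀ δ : Ext E T N, MemXi ξ δ → δ = 0)
    (hξ : IsProperClass ξ)
    {Y : C} (hY : Y ∈ Add {T}) (θ : Ext E Y N) (hθ : MemXi ξ θ) : θ = 0 := by
  -- Every extension in `ξ` by `N` is a pullback of the fixed `δ` along a map to `L`, and it splits
  -- iff that map lifts through `q`. Lifts can be chosen on each copy of `T`, so `E` need not turn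
  -- coproducts into products.
  obtain ⟨I, L, i, q, ⟨δ, hr, ht⟩, hInj⟩ := hI N
  obtain ⟨B, n, z, hz, htz⟩ := hθ
  obtain ⟨ι, j, r, hjr⟩ := exists_retract_of_mem_add hY
  obtain ⟨b, hb⟩ := hInj.exists_extension ⟨θ, hz, htz⟩ i
  obtain ⟨c, -, hc⟩ := hs.et3 hz hr (𝟙 N) b (by simpa using hb.symm)
  have hlift (f : T ⟶ L) : ∃ k : T ⟶ I, f = k ≫ q :=
    (hs.pull_eq_zero_iff hr f).1 (hN _ (MemXi.pull hξ ⟨_, _, _, hr, ht⟩ f))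
  choose k hk using hlift
  have hrc : r ≫ c = (Sigma.desc fun t => k (Sigma.ι (fun _ : ι => T) t ≫ r ≫ c)) ≫ q := by
    refine Sigma.hom_ext _ _ fun t => ?_
    rw [Sigma.ι_desc_assoc, ← hk]
  rw [← push_id θ, hc, hs.pull_eq_zero_iff hr]
  refine ⟨j ≫ Sigma.desc fun t => k (Sigma.ι (fun _ : ι => T) t ≫ r ≫ c), ?_⟩
  rw [Category.assoc, ← hrc, reassoc_of% hjr]

theorem IsXiTilting.rightPerp_eq_pres1 (hs : IsExtriangulated s) (hWIC : WIC s)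
    (hξ : IsProperClass ξ) (hP : EnoughXiProjectives ξ) (hI : EnoughXiInjectives ξ)
    (hgen : XiProjectivesGenerate ξ) {T : C} (hT : IsXiTilting ξ hP T) :
    rightPerp ξ hP {T} = Pres1 ξ (Add {T}) := by
  obtain ⟨K, P, x, y, hxy, hPP, hK⟩ := hT.pd_le.exists_resolution hs hWIC hξ hP hgen
  have hiff := subsingleton_xiExt_one_iff hs hP hxy hPP hK
  ext M
  rw [mem_rightPerp_singleton]
  constructor
  · intro hM
    obtain ⟨K', Q, x', y', hxy', hQ⟩ := hP M
    obtain ⟨T₀, T₁, u, v, huv, hT₀, hT₁⟩ := hT.coresolution Q hQ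
    -- Extensions in `ξ` of `T₁` by `M` split, so the deflation from `Q` extends along `u`.
    obtain ⟨f, rfl⟩ := exists_extension_of_memXi_eq_zero hs hξ huv
      (memXi_eq_zero_of_mem_add hs hI
        (memXi_eq_zero_of_exists_extension hs hxy hPP ((hiff M).1 hM)) hξ hT₁) y'
    obtain ⟨A, k, hk⟩ := exists_inXi_of_factorization hs hWIC hξ hxy' u f rfl
    exact ⟨A, T₀, k, f, hk, hT₀⟩
  · rintro ⟨K₁, Y, a, b, hab, hY⟩
    rw [hiff]
    intro f
    obtain ⟨ι, i, r, hir⟩ := exists_retract_of_mem_add hY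
    obtain ⟨g, rfl⟩ := hK.exists_lift hab f
    obtain ⟨k, hk⟩ := (hiff _).1 (hT.ext_zero ι) (g ≫ i)
    refine ⟨k ≫ r ≫ b, ?_⟩
    rw [← reassoc_of% hk, reassoc_of% hir]

/-- If `T^⊥ = Pres¹(Add T)`, then every `ξ`-projective object has an `Add T`-coresolution of
length one. -/
theorem exists_coresolution (hs : IsExtriangulated s) (hWIC : WIC s)
    (hξ : IsProperClass ξ) (hP : EnoughXiProjectives ξ) (hI : EnoughXiInjectives ξ)
    (hgen : XiProjectivesGenerate ξ) {T : C} (hT : XiPdLE ξ 1 T)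
    (h : rightPerp ξ hP {T} = Pres1 ξ (Add {T})) {P : C} (hPP : IsXiProjective ξ P) :
    ∃ (T₀ T₁ : C) (x : P ⟶ T₀) (y : T₀ ⟶ T₁), InXi ξ x y ∧ T₀ ∈ Add {T} ∧ T₁ ∈ Add {T} := by
  obtain ⟨K, Q, u, p, hup, hQ, hK⟩ := hT.exists_resolution hs hWIC hξ hP hgen
  have hiff (N : C) : N ∈ Pres1 ξ (Add {T}) ↔ ∀ f : K ⟶ N, ∃ k : Q ⟶ N, f = u ≫ k := by
    rw [← h, mem_rightPerp_singleton, subsingleton_xiExt_one_iff hs hP hup hQ hK]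
  have hadd := add_subset_pres1 hs hWIC hξ hP (Add {T})
  obtain ⟨κ, hκ, htκ⟩ := id hup
  -- the universal extension `P ⟶ B ⟶ T₁`, pulled back from an injective coresolution
  obtain ⟨I, L, i, q, ⟨δ, hδ, htδ⟩, hInj⟩ := hI P
  let T₁ := ∐ fun _ : T ⟶ L => T
  have hT₁ : T₁ ∈ Add {T} := sigma_mem_add T _
  let c : T₁ ⟶ L := Sigma.desc fun f => f
  obtain ⟨B, x, y, hxy⟩ := exists_realizes s (pull c δ)
  have hmem : InXi ξ x y := ⟨_, hxy, hξ.base_change _ htδ c x y hxy⟩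
  -- The map `T ⟶ L` inducing `θ` is itself one of the components of `c`.
  have huniv (θ : Ext E T P) (hθ : MemXi ξ θ) : ∃ t : T ⟶ T₁, θ = pull t (pull c δ) := by
    obtain ⟨D, d, e, hde, htde⟩ := hθ
    obtain ⟨b, hb⟩ := hInj.exists_extension ⟨θ, hde, htde⟩ i
    obtain ⟨f, -, hf⟩ := hs.et3 hde hδ (𝟙 P) b (by simpa using hb.symm)
    refine ⟨Sigma.ι (fun _ : T ⟶ L => T) f, ?_⟩
    rw [← pull_comp, Sigma.ι_desc, ← hf, push_id]
  have hB : B ∈ Pres1 ξ (Add {T}) := by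
    rw [hiff]
    intro f
    -- The image of `f` in `T₁` extends to `Q` and lifts to `B`. The remaining part comes from `w :
    -- K ⟶ P`, whose obstruction is a pullback of the class of `x`, `y` by universality and so dies
    -- under `x`.
    obtain ⟨g, hg⟩ := (hiff T₁).1 (hadd hT₁) (f ≫ y)
    obtain ⟨g', rfl⟩ := hQ.exists_lift hmem g
    obtain ⟨w, hw⟩ := hs.exists_lift hxy (f - u ≫ g') (by simp [Preadditive.sub_comp, hg])
    obtain ⟨t, ht⟩ := huniv (push w κ) (MemXi.push hξ ⟨_, _, _, hκ, htκ⟩ w)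
    obtain ⟨k, hk⟩ := (hs.push_eq_zero_iff hκ (w ≫ x)).1 (by
      rw [push_comp, ht, push_pull, hs.push_inflation hxy, pull_zero])
    refine ⟨g' + k, ?_⟩
    rw [Preadditive.comp_add, ← hk, ← hw]
    abel
  refine ⟨B, T₁, x, y, hmem, ?_, hT₁⟩
  obtain ⟨K', Y, a, b, hab, hY⟩ := hB
  obtain ⟨ι, j, r, hjr⟩ := exists_retract_of_mem_add hY
  -- Every map to `B` from a coproduct of copies of `T` factors through the evaluation `ev`; so does
  -- the deflation `b`, which makes `ev` a deflation in `ξ`.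
  let T₀ := ∐ fun _ : T ⟶ B => T
  have hT₀ : T₀ ∈ Add {T} := sigma_mem_add T _
  let ev : T₀ ⟶ B := Sigma.desc fun f => f
  have hev (f : T ⟶ B) : Sigma.ι (fun _ : T ⟶ B => T) f ≫ ev = f := Sigma.ι_desc _ _
  have hr : (Sigma.desc fun t => Sigma.ι (fun _ : T ⟶ B => T)
      (Sigma.ι (fun _ : ι => T) t ≫ r ≫ b)) ≫ ev = r ≫ b := by
    refine Sigma.hom_ext _ _ fun t => ?_
    rw [Sigma.ι_desc_assoc, hev]
  obtain ⟨A, k, hk⟩ := exists_inXi_of_factorization hs hWIC hξ hab (j ≫ Sigma.desc fun t =>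
    Sigma.ι (fun _ : T ⟶ B => T) (Sigma.ι (fun _ : ι => T) t ≫ r ≫ b)) ev
    (by rw [Category.assoc, hr, reassoc_of% hjr])
  -- the deflation `T₀ ⟶ B` splits
  obtain ⟨l, hl⟩ := hPP.exists_lift hk x
  have hN := memXi_eq_zero_of_exists_extension hs hup hQ ((hiff T₀).1 (hadd hT₀))
  obtain ⟨m, rfl⟩ := exists_extension_of_memXi_eq_zero hs hξ hmem
    (memXi_eq_zero_of_mem_add hs hI hN hξ hT₁) l
  -- The map `m` is a section of `ev` up to a term factoring through `T₁`, and that term lifts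
  -- through `ev` copy by copy.
  obtain ⟨n, hn⟩ := hs.exists_desc hxy (𝟙 B - m ≫ ev) (by
    rw [Preadditive.comp_sub, Category.comp_id, ← Category.assoc, ← hl, sub_self])
  have hn' : (Sigma.desc fun t => Sigma.ι (fun _ : T ⟶ B => T)
      (Sigma.ι (fun _ : T ⟶ L => T) t ≫ n)) ≫ ev = n := by
    refine Sigma.hom_ext _ _ fun t => ?_
    rw [Sigma.ι_desc_assoc, hev]
  obtain ⟨ζ, hζ, -⟩ := hk
  have hζ0 : ζ = 0 := by
    rw [← pull_id ζ, hs.pull_eq_zero_iff hζ]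
    exact ⟨m + y ≫ _, by rw [Preadditive.add_comp, Category.assoc, hn', ← hn]; abel⟩
  obtain ⟨e⟩ := hs.nonempty_iso_biprod hζ hζ0
  exact ⟨T ⟶ B, fun _ => T, A, fun _ => rfl, ⟨biprod.braiding B A ≪≫ e.symm⟩⟩

theorem isXiTilting_of_rightPerp_eq_pres1 (hs : IsExtriangulated s) (hWIC : WIC s)
    (hξ : IsProperClass ξ) (hP : EnoughXiProjectives ξ) (hI : EnoughXiInjectives ξ)
    (hgen : XiProjectivesGenerate ξ) (hC : ∃ X : C, ¬ IsZero X) {T : C}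
    (h : rightPerp ξ hP {T} = Pres1 ξ (Add {T})) : IsXiTilting ξ hP T := by
  have hmem (Y : C) : Subsingleton (XiExt ξ hP 1 T Y) ↔ Y ∈ Pres1 ξ (Add {T}) := by
    rw [← h, mem_rightPerp_singleton]
  have hpd : XiPdLE ξ 1 T :=
    xiPdLE_one_of_subsingleton hs hWIC hξ hP hI hgen T fun M I L i q hiq hInj =>
      (hmem L).2 (mem_pres1_of_inXi hs hWIC hξ hP hiq
        ((hmem I).1 (subsingleton_xiExt_one_of_isXiInjective hs hP hInj T)))
  refine ⟨fun hT => ?_, hpd, fun ι => ?_, fun P hPP =>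
    exists_coresolution hs hWIC hξ hP hI hgen hpd h hPP⟩
  · obtain ⟨X, hX⟩ := hC
    obtain ⟨K, Q, u, p, hup, hQ, hK⟩ := hpd.exists_resolution hs hWIC hξ hP hgen
    -- If `T` were zero, `u` would have a retraction, so `T^⊥` would be everything; but `Add T`
    -- would contain only zero objects, and generation would force `X = 0`.
    have hXT : X ∈ Pres1 ξ (Add {T}) := by
      rw [← hmem, subsingleton_xiExt_one_iff hs hP hup hQ hK]
      obtain ⟨δ, hδ, htδ⟩ := hup
      intro f
      obtain ⟨k, hk⟩ := hs.exists_lift hδ (𝟙 Q) (hT.eq_of_tgt _ _)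
      refine ⟨k ≫ f, ?_⟩
      have : u ≫ k - 𝟙 K = 0 := hK.eq_zero_of_comp ⟨δ, hδ, htδ⟩ (by
        rw [Preadditive.sub_comp, Category.assoc, ← hk, Category.comp_id, Category.id_comp,
          sub_self])
      rw [← Category.assoc, sub_eq_zero.1 this, Category.id_comp]
    obtain ⟨A, Y, a, b, hab, hY⟩ := hXT
    obtain ⟨ι, i, r, hir⟩ := exists_retract_of_mem_add hY
    have hY0 : IsZero Y := by
      rw [IsZero.iff_id_eq_zero, ← hir, Sigma.hom_ext r 0 fun _ => hT.eq_of_src _ _, comp_zero]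
    exact hX (hgen X fun R hR f => by
      obtain ⟨l, rfl⟩ := hR.exists_lift hab f
      rw [hY0.eq_of_tgt l 0, zero_comp])
  · exact (hmem _).2 (add_subset_pres1 hs hWIC hξ hP _ (sigma_mem_add T ι))

end Tilting

end Extri

theorem theorem3p4 {C : Type u} [Category.{v} C] [Preadditive C]
    [HasZeroObject C] [HasBinaryBiproducts C] [HasCoproducts.{v} C]
    {E : Cᵒᵖ ⥤ C ⥤ AddCommGrpCat.{w}} (s : Extri.Correspondence E)
    (hs : Extri.IsExtriangulated s) (hWIC : Extri.WIC s)
    (ξ : Set (Extri.ETriangle s)) (hξ : Extri.IsProperClass ξ)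
    (hP : Extri.EnoughXiProjectives ξ) (hI : Extri.EnoughXiInjectives ξ)
    (hgen : Extri.XiProjectivesGenerate ξ)
    (hC : ∃ X : C, ¬ IsZero X) (T : C) :
    Extri.IsXiTilting ξ hP T ↔
      Extri.rightPerp ξ hP {T} = Extri.Pres1 ξ (Extri.Add {T}) :=
  ⟨fun hT => hT.rightPerp_eq_pres1 hs hWIC hξ hP hI hgen,
    Extri.isXiTilting_of_rightPerp_eq_pres1 hs hWIC hξ hP hI hgen hC⟩
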